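/- **Theorem (Sheffer theorem for symmetric functions).** Let $K$ be a field of characteristic zero, let $\Lambda$ be the $K$-algebra of symmetric functions in countably many variables $x=(x_1,x_2,\ldots)$ (the symmetric formal power series of bounded degree), and let $y$ be a further variable. The symmetric shift $E^y:\Lambda\to\Lambda[y]$ is given by $E^yq(x_1,x_2,\ldots)=q(y,x_1,x_2,\ldots)$; for a constant $a\in K$ one likewise has $E^a:\Lambda\to\Lambda$. A $K$-linear map $F^y:\Lambda\to\Lambda[y]$ is called shift-invariant if $E^aF^y=F^yE^a$ for all $a\in K$, where $E^a$ is extended $K[y]$-linearly to $\Lambda[y]$. For partitions $\mu,\nu$ write $\nu\ll\mu$ if there is an $i$ with $\nu_i<\mu_i$ and $\nu_j=\mu_j$ for all $j>i$. Let $m_\mu$ be the monomial symmetric functions and $\lambda'$ the conjugate of $\lambda$. A full sequence is a family $(p_\lambda)$ in $\Lambda$, indexed by all partitions, such that each $p_\lambda$ is homogeneous of degree $|\lambda|$ and of the form $p_\lambda=\sum_{\mu}b_{\lambda\mu}m_\mu$, the sum being over $\mu=\lambda'$ and $\mu\gg\lambda'$, with $b_{\lambda\lambda'}\neq0$. For a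 finitely supported integer vector $\alpha$ put $p_\alpha=p_\lambda$ if $\alpha$ has no negative entry and $\lambda$ is the partition that rearranges $\alpha$, and $p_\alpha=0$ if $\alpha$ has a negative entry. A full divided power sequence is a full sequence $(q_\lambda)$ such that, for every partition $\lambda$, $$E^y q_\lambda(x_1,x_2,\ldots)=\sum_\alpha q_\alpha(x_1,x_2,\ldots)\,q_{\lambda-\alpha}(y,0,0,\ldots),$$ the sum being over all finitely supported integer vectors $\alpha$ (only finitely many terms are nonzero). Let $F^y:\Lambda\to\Lambda[y]$ be a shift-invariant $K$-linear map and $(p_\lambda)$ a full sequence such that, for every partition $\lambda$, $$F^y p_\lambda(x_1,x_2,\ldots)=\sum_\alpha p_\alpha(x_1,x_2,\ldots)\,p_{\lambda-\alpha}(y,0,0,\ldots).$$ Then there is a nonzero constant $c\in K$ such that $F^y=c\,E^y$ and $p_\lambda=c\,q_\lambda$ for all $\lambda$, where $(q_\lambda)$ is a full divided power sequence. -/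

import Mathlib

noncomputable section

namespace ShefferSym

open Polynomial

/-! ### The algebra of symmetric functions in `x₁, x₂, …` -/

/-- The algebra `Λ` of symmetric functions over `K` in countably many variables: the formal power
series of bounded degree that are fixed by every permutation of the variables. The variable
`x_{i+1}` is indexed by `i : ℕ`. -/
def SymFun (K : Type*) [Field K] : Subalgebra K (MvPowerSeries ℕ K) where
  carrier := {f | (∀ σ : Equiv.Perm ℕ, MvPowerSeries.rename σ f = f) ∧
    ∃ N : ℕ, ∀ d : ℕ →₀ ℕ, MvPowerSeries.coeff d f ≠ 0 → d.degree ≤ N}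
  mul_mem' := by
    rintro f g ⟨hf, N, hN⟩ ⟨hg, M, hM⟩
    refine ⟨fun σ => by rw [map_mul, hf, hg], N + M, fun d hd => ?_⟩
    classical
    rw [MvPowerSeries.coeff_mul] at hd
    obtain ⟨⟨a, b⟩, hab, hne⟩ := Finset.exists_ne_zero_of_sum_ne_zero hd
    rw [Finset.HasAntidiagonal.mem_antidiagonal] at hab
    have h1 := hN a (left_ne_zero_of_mul hne)
    have h2 := hM b (right_ne_zero_of_mul hne)
    have h3 : d.degree = a.degree + b.degree := by
      rw [← hab]; exact map_add Finsupp.degree a b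
    omega
  add_mem' := by
    rintro f g ⟨hf, N, hN⟩ ⟨hg, M, hM⟩
    refine ⟨fun σ => by rw [map_add, hf, hg], max N M, fun d hd => ?_⟩
    by_cases h : MvPowerSeries.coeff d f = 0
    · refine (hM d fun h' => hd ?_).trans (le_max_right _ _)
      rw [map_add, h, h', add_zero]
    · exact (hN d h).trans (le_max_left _ _)
  algebraMap_mem' := by
    intro r
    refine ⟨fun σ => AlgHom.commutes _ r, 0, fun d hd => ?_⟩
    classical
    rw [MvPowerSeries.algebraMap_apply, MvPowerSeries.coeff_C] at hd
    have : d = 0 := by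
      by_contra h
      exact hd (if_neg h)
    simp [this]

variable {K : Type*} [Field K]

/-- The coefficient of the monomial `x^d` in a symmetric function. -/
def cf (d : ℕ →₀ ℕ) : SymFun K →ₗ[K] K :=
  (MvPowerSeries.coeff d).comp (SymFun K).val.toLinearMap

theorem cf_perm (f : SymFun K) (σ : Equiv.Perm ℕ) (d : ℕ →₀ ℕ) :
    cf (d.embDomain σ.toEmbedding) f = cf d f := by
  have h := MvPowerSeries.coeff_embDomain_rename σ.toEmbedding (f : MvPowerSeries ℕ K) d
  rw [show MvPowerSeries.rename (⇑σ.toEmbedding) (f : MvPowerSeries ℕ K) = f from f.2.1 σ] at h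
  exact h

theorem rename_eq_of_coeff (f : MvPowerSeries ℕ K)
    (h : ∀ (σ : Equiv.Perm ℕ) (d : ℕ →₀ ℕ),
      MvPowerSeries.coeff (d.embDomain σ.toEmbedding) f = MvPowerSeries.coeff d f)
    (σ : Equiv.Perm ℕ) : MvPowerSeries.rename σ f = f := by
  ext d
  have hd : d = (d.embDomain σ.symm.toEmbedding).embDomain σ.toEmbedding := by
    ext i
    obtain ⟨j, rfl⟩ := σ.surjective i
    have h1 := Finsupp.embDomain_apply_self σ.toEmbedding (d.embDomain σ.symm.toEmbedding) j
    have h2 := Finsupp.embDomain_apply_self σ.symm.toEmbedding d (σ j)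
    simp only [Equiv.coe_toEmbedding, Equiv.symm_apply_apply] at h1 h2
    rw [h1, h2]
  rw [hd, h]
  exact MvPowerSeries.coeff_embDomain_rename σ.toEmbedding f _

/-- `f` is homogeneous of degree `n`. -/
def IsHomog (f : SymFun K) (n : ℕ) : Prop :=
  ∀ d : ℕ →₀ ℕ, cf d f ≠ 0 → d.degree = n

/-- The polynomial with prescribed coefficients. -/
def polyOfCoeff {R : Type*} [Semiring R] (f : ℕ → R) (hf : (Function.support f).Finite) : R[X] :=
  ⟨.ofCoeff (Finsupp.ofSupportFinite f hf)⟩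

@[simp]
theorem coeff_polyOfCoeff {R : Type*} [Semiring R] (f : ℕ → R)
    (hf : (Function.support f).Finite) (n : ℕ) : (polyOfCoeff f hf).coeff n = f n := by
  rw [polyOfCoeff, coeff_ofFinsupp]
  rfl

/-! ### The symmetric shift -/

/-- The exponent vector `(n, d₁, d₂, …)`. -/
def consExp (n : ℕ) (d : ℕ →₀ ℕ) : ℕ →₀ ℕ :=
  Finsupp.single 0 n + d.embDomain ⟨Nat.succ, Nat.succ_injective⟩

@[simp]
theorem consExp_zero (n : ℕ) (d : ℕ →₀ ℕ) : consExp n d 0 = n := by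
  have : (d.embDomain ⟨Nat.succ, Nat.succ_injective⟩) 0 = 0 :=
    Finsupp.embDomain_of_notMem_range _ _ _ (by simp)
  simp [consExp, this]

@[simp]
theorem consExp_succ (n : ℕ) (d : ℕ →₀ ℕ) (i : ℕ) : consExp n d (i + 1) = d i := by
  have := Finsupp.embDomain_apply_self ⟨Nat.succ, Nat.succ_injective⟩ d i
  simp only [Function.Embedding.coeFn_mk, Nat.succ_eq_add_one] at this
  simp [consExp, this]

theorem degree_consExp (n : ℕ) (d : ℕ →₀ ℕ) : (consExp n d).degree = n + d.degree := by
  rw [consExp, map_add, Finsupp.degree_single]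
  congr 1
  change ∑ i ∈ _, _ = ∑ i ∈ _, _
  rw [Finsupp.support_embDomain, Finset.sum_map]
  exact Finset.sum_congr rfl fun i _ => Finsupp.embDomain_apply_self _ d i

/-- The permutation of `ℕ` that fixes `0` and acts as `σ` on the successors. -/
def succPerm (σ : Equiv.Perm ℕ) : Equiv.Perm ℕ where
  toFun i := Nat.casesOn i 0 fun j => σ j + 1
  invFun i := Nat.casesOn i 0 fun j => σ.symm j + 1
  left_inv i := by cases i <;> simp
  right_inv i := by cases i <;> simp

theorem consExp_perm (n : ℕ) (d : ℕ →₀ ℕ) (σ : Equiv.Perm ℕ) :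
    consExp n (d.embDomain σ.toEmbedding) =
      (consExp n d).embDomain (succPerm σ).toEmbedding := by
  ext i
  obtain ⟨j, rfl⟩ := (succPerm σ).surjective i
  have h1 := Finsupp.embDomain_apply_self (succPerm σ).toEmbedding (consExp n d) j
  rw [Equiv.coe_toEmbedding] at h1
  rw [h1]
  cases j with
  | zero => simp [succPerm]
  | succ j =>
    have h2 := Finsupp.embDomain_apply_self σ.toEmbedding d j
    rw [Equiv.coe_toEmbedding] at h2
    simp [succPerm, h2]

/-- The coefficient of `y^n` in `q(y, x₁, x₂, …)`, a symmetric function of `x₁, x₂, …`: its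
coefficient at `x^d` is the coefficient of `q` at `(n, d₁, d₂, …)`. -/
def shiftCoeff (n : ℕ) : SymFun K →ₗ[K] SymFun K where
  toFun q := ⟨fun d => cf (consExp n d) q, by
    refine ⟨rename_eq_of_coeff _ fun σ d => ?_, ?_⟩
    · change cf (consExp n (d.embDomain σ.toEmbedding)) q = cf (consExp n d) q
      rw [consExp_perm, cf_perm]
    · obtain ⟨N, hN⟩ := q.2.2
      refine ⟨N, fun d hd => ?_⟩
      have := hN (consExp n d) hd
      rw [degree_consExp] at this
      omega⟩
  map_add' f g := by
    apply Subtype.ext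
    funext d
    exact map_add (cf (consExp n d)) f g
  map_smul' r f := by
    apply Subtype.ext
    funext d
    exact map_smul (cf (consExp n d)) r f

theorem cf_shiftCoeff (n : ℕ) (q : SymFun K) (d : ℕ →₀ ℕ) :
    cf d (shiftCoeff n q) = cf (consExp n d) q := rfl

theorem shiftCoeff_support (q : SymFun K) :
    (Function.support fun n => shiftCoeff n q).Finite := by
  obtain ⟨N, hN⟩ := q.2.2
  refine (Set.finite_Iic N).subset fun n hn => ?_
  by_contra h
  refine hn (Subtype.ext (funext fun d => ?_))
  by_contra h'
  have := hN (consExp n d) h'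
  rw [degree_consExp] at this
  simp only [Set.mem_Iic] at h
  omega

/-- The symmetric shift `E^y : Λ → Λ[y]`, `q(x₁, x₂, …) ↦ q(y, x₁, x₂, …)`, with `y` a variable. -/
def shift : SymFun K →ₗ[K] (SymFun K)[X] where
  toFun q := polyOfCoeff (fun n => shiftCoeff n q) (shiftCoeff_support q)
  map_add' f g := by ext1 n; simp
  map_smul' r f := by ext1 n; simp

/-- The symmetric shift `E^a : Λ → Λ`, `q(x₁, x₂, …) ↦ q(a, x₁, x₂, …)`, with `a` a constant. -/
def shiftAt (a : K) : SymFun K →ₗ[K] SymFun K where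
  toFun q := (shift q).eval (algebraMap K (SymFun K) a)
  map_add' f g := by rw [map_add, eval_add]
  map_smul' r f := by rw [map_smul, eval_smul, RingHom.id_apply]

/-- `F : Λ → Λ[y]` is shift-invariant: `E^a F = F E^a` for all constants `a`, where `E^a` acts on
`Λ[y]` by its `K[y]`-linear extension, that is, on each coefficient of a polynomial in `y`. -/
def IsShiftInvariant (F : SymFun K →ₗ[K] (SymFun K)[X]) : Prop :=
  ∀ (a : K) (q : SymFun K) (n : ℕ), (F (shiftAt a q)).coeff n = shiftAt a ((F q).coeff n)

theorem evalOne_support (q : SymFun K) :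
    (Function.support fun n => cf (Finsupp.single 0 n) q).Finite := by
  obtain ⟨N, hN⟩ := q.2.2
  refine (Set.finite_Iic N).subset fun n hn => ?_
  have := hN (Finsupp.single 0 n) hn
  rwa [Finsupp.degree_single] at this

/-- The polynomial `q(y, 0, 0, …)` in `K[y]`. -/
def evalOne (q : SymFun K) : K[X] :=
  polyOfCoeff (fun n => cf (Finsupp.single 0 n) q) (evalOne_support q)

/-! ### Partitions

A partition `λ₁ ≥ λ₂ ≥ …` is a Young diagram `lam` with `λ_{i+1} = lam.rowLen i`; its conjugate is
`lam.transpose` and the number it partitions is `lam.card`. -/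

/-- The partition as a finitely supported vector `(λ₁, λ₂, …)` of integers. -/
def partVec (lam : YoungDiagram) : ℕ →₀ ℤ :=
  Finsupp.ofSupportFinite (fun i => (lam.rowLen i : ℤ)) (by
    refine (Set.finite_Iio (lam.colLen 0)).subset fun i hi => ?_
    have h : 0 < lam.rowLen i := Nat.pos_of_ne_zero fun h => hi (by simp [h])
    exact YoungDiagram.mem_iff_lt_colLen.1 (YoungDiagram.mem_iff_lt_rowLen.2 h))

/-- The reverse lexicographic order `α ≪ β` on partitions. -/
def RevLexLT (α β : YoungDiagram) : Prop :=
  ∃ i, α.rowLen i < β.rowLen i ∧ ∀ j, i < j → α.rowLen j = β.rowLen j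

/-- The partition obtained from a finitely supported vector of natural numbers by sorting its
nonzero entries in decreasing order. -/
def sortVec (d : ℕ →₀ ℕ) : YoungDiagram :=
  YoungDiagram.ofRowLens ((d.support.val.map d).sort (· ≥ ·))
    (Multiset.pairwise_sort (d.support.val.map d) (· ≥ ·)).sortedGE

theorem sortVec_perm (d : ℕ →₀ ℕ) (σ : Equiv.Perm ℕ) :
    sortVec (d.embDomain σ.toEmbedding) = sortVec d := by
  have h : (d.embDomain σ.toEmbedding).support.val.map (d.embDomain σ.toEmbedding) =
      d.support.val.map d := by
    rw [Finsupp.support_embDomain, Finset.map_val, Multiset.map_map]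
    refine Multiset.map_congr rfl fun i _ => ?_
    exact Finsupp.embDomain_apply_self σ.toEmbedding d i
  simp only [sortVec, h]

theorem card_ofRowLens (w : List ℕ) (hw : w.SortedGE) :
    (YoungDiagram.ofRowLens w hw).card = w.sum := by
  change (YoungDiagram.cellsOfRowLens w).card = w.sum
  clear hw
  induction w with
  | nil => rfl
  | cons a l ih =>
    rw [YoungDiagram.cellsOfRowLens, Finset.card_union_of_disjoint]
    · simp [ih]
    · rw [Finset.disjoint_left]
      rintro ⟨i, j⟩ h1 h2
      simp only [Finset.mem_product, Finset.mem_singleton] at h1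
      simp only [Finset.mem_map, Function.Embedding.prodMap, Prod.exists] at h2
      obtain ⟨k, l, -, h⟩ := h2
      have := congrArg Prod.fst h
      simp at this
      omega

theorem card_sortVec (d : ℕ →₀ ℕ) : (sortVec d).card = d.degree := by
  rw [sortVec, card_ofRowLens, ← Multiset.sum_coe, Multiset.sort_eq]
  rfl

open Classical in
/-- The monomial symmetric function `m_μ`: the sum of all distinct monomials whose exponent vector
is a rearrangement of `μ`. -/
def monomialSym (K : Type*) [Field K] (μ : YoungDiagram) : SymFun K :=
  ⟨fun d => if sortVec d = μ then 1 else 0, by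
    refine ⟨rename_eq_of_coeff _ fun σ d => ?_, μ.card, fun d hd => ?_⟩
    · change (if sortVec (d.embDomain σ.toEmbedding) = μ then (1 : K) else 0) =
        if sortVec d = μ then 1 else 0
      rw [sortVec_perm]
    · have h : sortVec d = μ := by
        by_contra h
        exact hd (if_neg h)
      rw [← h, card_sortVec]⟩

/-! ### Full sequences and full divided power sequences -/

/-- A full sequence: `p_λ` is homogeneous of degree `|λ|` and is a linear combination of the `m_μ`
with `μ = λ'` or `μ ≫ λ'`, where the coefficient of `m_{λ'}` is nonzero. -/
def IsFull (p : YoungDiagram → SymFun K) : Prop :=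
  ∀ lam : YoungDiagram, IsHomog (p lam) lam.card ∧
    ∃ b : YoungDiagram →₀ K,
      (∀ μ, b μ ≠ 0 → μ = lam.transpose ∨ RevLexLT lam.transpose μ) ∧
      b lam.transpose ≠ 0 ∧
      p lam = b.sum fun μ c => c • monomialSym K μ

open Classical in
/-- The extension of `p` to finitely supported integer vectors `α`: `p_α = p_λ` for the partition
`λ` that is a rearrangement of `α` if `α` is nonnegative, and `p_α = 0` otherwise. -/
def extend (p : YoungDiagram → SymFun K) (α : ℕ →₀ ℤ) : SymFun K :=
  if ∀ i, 0 ≤ α i then p (sortVec (α.mapRange Int.toNat Int.toNat_zero)) else 0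

/-- The term `p_α(x₁, x₂, …) p_{λ-α}(y, 0, 0, …)` in `Λ[y]`. -/
def convTerm (p : YoungDiagram → SymFun K) (lam : YoungDiagram) (α : ℕ →₀ ℤ) : (SymFun K)[X] :=
  C (extend p α) * (evalOne (extend p (partVec lam - α))).map (algebraMap K (SymFun K))

/-- Only finitely many terms of the convolution are nonzero. -/
theorem convTerm_support (p : YoungDiagram → SymFun K) (lam : YoungDiagram) :
    (Function.support (convTerm p lam)).Finite := by
  refine (Set.finite_Icc (0 : ℕ →₀ ℤ) (partVec lam)).subset fun α hα => ?_
  rw [Function.mem_support] at hα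
  constructor
  · by_contra h
    refine hα ?_
    have h' : ¬ ∀ i, 0 ≤ α i := fun h'' => h fun i => h'' i
    rw [convTerm, extend, if_neg h', C_0, zero_mul]
  · by_contra h
    refine hα ?_
    have h' : ¬ ∀ i, 0 ≤ (partVec lam - α) i := fun h'' => h fun i => by
      have := h'' i
      rw [Finsupp.sub_apply] at this
      omega
    have h0 : evalOne (0 : SymFun K) = 0 := by
      ext n
      rw [evalOne, coeff_polyOfCoeff, map_zero, coeff_zero]
    rw [convTerm, extend, extend, if_neg h', h0, Polynomial.map_zero, mul_zero]

/-- The convolution identity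
`F^y p_λ(x₁, x₂, …) = ∑_α p_α(x₁, x₂, …) p_{λ-α}(y, 0, 0, …)` for all partitions `λ`, the sum
ranging over all finitely supported integer vectors `α`. -/
def Convolves (F : SymFun K →ₗ[K] (SymFun K)[X]) (p : YoungDiagram → SymFun K) : Prop :=
  ∀ lam : YoungDiagram, F (p lam) = ∑ᶠ α : ℕ →₀ ℤ, convTerm p lam α

/-- A full divided power sequence: a full sequence satisfying the convolution identity for the
symmetric shift. -/
def IsFullDividedPower (p : YoungDiagram → SymFun K) : Prop :=
  IsFull p ∧ Convolves shift p

end ShefferSym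

end

noncomputable section

namespace ShefferSym

open Polynomial

variable {K : Type*} [Field K]

/-! Take the constant term in x₁, x₂, … of the convolution identity. Since `p_α` is homogeneous of
positive degree for `α ≠ 0`, only `α = 0` survives, leaving `c · p_λ(y, 0, 0, …)` with `c = p_∅`,
which is `c` times the constant term of `E^y p_λ` (`constCoeff_conv`, `constCoeff_shift`). A full
sequence is triangular with respect to the `m_μ`, so it spans Λ (`IsFull.span_eq_top`), and by
linearity `F` and `c E^y` have the same constant terms on all of Λ.

Shift-invariance turns this into equality. Comparing coefficients of powers of `a` in `E^a F = F
E^a`, `F` commutes with every operator `shiftCoeff k` (`IsShiftInvariant.coeff_shiftCoeff`). Any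
coefficient of a symmetric function is the constant term of its image under a product of such
operators, so constant terms determine `F` (`IsShiftInvariant.eq_smul_shift`). Finally, the
convolution is quadratic in `p` while `F` is linear, so `c⁻¹ p` is a divided power sequence for
`E^y`. -/

theorem ext_cf {f g : SymFun K} (h : ∀ d, cf d f = cf d g) : f = g :=
  Subtype.ext (MvPowerSeries.ext h)

/-! ### Sorting exponent vectors -/

theorem map_support_eq_of_sortVec_eq {d e : ℕ →₀ ℕ} (h : sortVec d = sortVec e) :
    d.support.val.map d = e.support.val.map e := by
  have key : ∀ d : ℕ →₀ ℕ,
      (sortVec d).rowLens = (d.support.val.map d).sort (· ≥ ·) := fun d => by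
    refine YoungDiagram.rowLens_ofRowLens_eq_self fun x hx => ?_
    rw [Multiset.mem_sort, Multiset.mem_map] at hx
    obtain ⟨i, hi, rfl⟩ := hx
    exact Nat.pos_of_ne_zero (Finsupp.mem_support_iff.1 hi)
  have h' := (key d).symm.trans ((congrArg _ h).trans (key e))
  rw [← Multiset.sort_eq (d.support.val.map d) (· ≥ ·), h', Multiset.sort_eq]

theorem card_fiber_eq_count (d : ℕ →₀ ℕ) {v : ℕ} (hv : v ≠ 0) :
    Nat.card {i // d i = v} = (d.support.val.map d).count v := by
  rw [Multiset.count_map, ← Finset.filter_val, Finset.card_val, Nat.subtype_card]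
  intro i
  rw [Finset.mem_filter, Finsupp.mem_support_iff]
  exact ⟨fun h => h.2.symm, fun h => ⟨by rwa [h], h.symm⟩⟩

theorem finite_fiber (d : ℕ →₀ ℕ) {v : ℕ} (hv : v ≠ 0) : Finite {i // d i = v} :=
  (d.hasFiniteSupport.subset fun i (hi : d i = v) => by
    rw [Function.mem_support, hi]; exact hv).to_subtype

theorem infinite_zero_fiber (d : ℕ →₀ ℕ) : Infinite {i // d i = 0} := by
  have h := d.hasFiniteSupport.infinite_compl
  have h' : (Function.support d)ᶜ = {i | d i = 0} := by ext; simp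
  rw [h'] at h
  exact h.to_subtype

/-- Exponent vectors that sort to the same partition differ by a permutation. -/
theorem exists_perm_of_sortVec_eq {d e : ℕ →₀ ℕ} (h : sortVec d = sortVec e) :
    ∃ σ : Equiv.Perm ℕ, d.embDomain σ.toEmbedding = e := by
  -- The permutation is glued from bijections between level sets: for `v ≠ 0` these are finite of
  -- equal size, for `v = 0` both are countably infinite.
  have hfib : ∀ v, Nonempty ({i // d i = v} ≃ {i // e i = v}) := fun v => by
    by_cases hv : v = 0
    · subst hv
      have := infinite_zero_fiber d
      have := infinite_zero_fiber e
      exact nonempty_equiv_of_countable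
    · have := finite_fiber d hv
      have := finite_fiber e hv
      refine Finite.card_eq.1 ?_
      rw [card_fiber_eq_count d hv, card_fiber_eq_count e hv, map_support_eq_of_sortVec_eq h]
  let σ : Equiv.Perm ℕ := Equiv.ofFiberEquiv fun v => (hfib v).some
  refine ⟨σ, Finsupp.ext fun i => ?_⟩
  obtain ⟨j, rfl⟩ := σ.surjective i
  have h1 := Finsupp.embDomain_apply_self σ.toEmbedding d j
  rw [Equiv.coe_toEmbedding] at h1
  rw [h1]
  exact (Equiv.ofFiberEquiv_map (fun v => (hfib v).some) j).symm

theorem cf_eq_of_sortVec_eq (f : SymFun K) {d e : ℕ →₀ ℕ} (h : sortVec d = sortVec e) :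
    cf d f = cf e f := by
  obtain ⟨σ, rfl⟩ := exists_perm_of_sortVec_eq h
  exact (cf_perm f σ d).symm

/-- The parts of a partition as an exponent vector. -/
def partExp (μ : YoungDiagram) : ℕ →₀ ℕ := (partVec μ).mapRange Int.toNat Int.toNat_zero

@[simp]
theorem partExp_apply (μ : YoungDiagram) (i : ℕ) : partExp μ i = μ.rowLen i := by
  change ((μ.rowLen i : ℤ)).toNat = _
  simp

theorem support_partExp (μ : YoungDiagram) : (partExp μ).support = Finset.range (μ.colLen 0) := by
  ext i
  rw [Finsupp.mem_support_iff, partExp_apply, Finset.mem_range, ← YoungDiagram.mem_iff_lt_colLen,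
    YoungDiagram.mem_iff_lt_rowLen, Nat.pos_iff_ne_zero]

@[simp]
theorem sortVec_partExp (μ : YoungDiagram) : sortVec (partExp μ) = μ := by
  have h : ((partExp μ).support.val.map (partExp μ)).sort (· ≥ ·) = μ.rowLens := by
    rw [support_partExp, Finset.range_val, Multiset.map_congr rfl fun i _ => partExp_apply μ i]
    change ((List.range _ : Multiset ℕ).map _).sort _ = _
    rw [Multiset.map_coe, Multiset.coe_sort]
    exact List.mergeSort_eq_self _ (by simpa [YoungDiagram.rowLens] using μ.rowLens_sorted.pairwise)
  rw [sortVec]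
  simp only [h]
  exact YoungDiagram.ofRowLens_to_rowLens_eq_self

/-! ### Monomial symmetric functions and full sequences span -/

open Classical in
theorem cf_monomialSym (d : ℕ →₀ ℕ) (μ : YoungDiagram) :
    cf d (monomialSym K μ) = if sortVec d = μ then 1 else 0 := rfl

theorem cf_sum_monomialSym (b : YoungDiagram →₀ K) (d : ℕ →₀ ℕ) :
    cf d (b.sum fun μ c => c • monomialSym K μ) = b (sortVec d) := by
  classical
  simp only [Finsupp.sum, map_sum, map_smul, cf_monomialSym, smul_eq_mul, mul_ite, mul_one,
    mul_zero, Finset.sum_ite_eq]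
  simp +contextual [eq_comm]

/-- A cell `(i, j)` forces `i + 1` cells in its column and `j + 1` in its row, so the diagram fits
in an `N × N` box. -/
theorem finite_card_le (N : ℕ) : {μ : YoungDiagram | μ.card ≤ N}.Finite := by
  have hinj : Function.Injective YoungDiagram.cells := fun μ ν h => YoungDiagram.ext h
  refine Set.Finite.of_finite_image (f := YoungDiagram.cells) ?_ hinj.injOn
  refine (Finset.finite_toSet (Finset.range N ×ˢ Finset.range N).powerset).subset ?_
  rintro _ ⟨μ, hμ, rfl⟩
  rw [Finset.mem_coe, Finset.mem_powerset]
  rintro ⟨i, j⟩ hij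
  have hsub : (Finset.range (i + 1)).image (fun k => (k, j)) ⊆ μ.cells := fun x hx => by
    obtain ⟨k, hk, rfl⟩ := Finset.mem_image.1 hx
    exact μ.up_left_mem (Nat.lt_succ_iff.1 (Finset.mem_range.1 hk)) le_rfl hij
  have hsub' : (Finset.range (j + 1)).image (fun k => (i, k)) ⊆ μ.cells := fun x hx => by
    obtain ⟨k, hk, rfl⟩ := Finset.mem_image.1 hx
    exact μ.up_left_mem le_rfl (Nat.lt_succ_iff.1 (Finset.mem_range.1 hk)) hij
  have h1 := Finset.card_le_card hsub
  have h2 := Finset.card_le_card hsub'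
  rw [Finset.card_image_of_injective _ fun a b h => congrArg Prod.fst h, Finset.card_range] at h1
  rw [Finset.card_image_of_injective _ fun a b h => congrArg Prod.snd h, Finset.card_range] at h2
  have hμ' : μ.cells.card ≤ N := hμ
  rw [Finset.mem_product, Finset.mem_range, Finset.mem_range]
  constructor <;> dsimp only <;> omega

theorem span_monomialSym : Submodule.span K (Set.range (monomialSym K)) = ⊤ := by
  refine eq_top_iff.2 fun f _ => ?_
  obtain ⟨N, hN⟩ := f.2.2
  let b : YoungDiagram →₀ K := Finsupp.ofSupportFinite (fun μ => cf (partExp μ) f)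
    ((finite_card_le N).subset fun μ hμ => by
      have := hN (partExp μ) hμ
      rwa [← card_sortVec, sortVec_partExp] at this)
  have hf : f = b.sum fun μ c => c • monomialSym K μ := ext_cf fun d => by
    rw [cf_sum_monomialSym]
    exact cf_eq_of_sortVec_eq f (sortVec_partExp _).symm
  rw [hf]
  exact Submodule.sum_mem _ fun μ _ => Submodule.smul_mem _ _ (Submodule.subset_span ⟨μ, rfl⟩)

theorem RevLexLT.irrefl (α : YoungDiagram) : ¬ RevLexLT α α := fun ⟨_, h, _⟩ => lt_irrefl _ h

theorem RevLexLT.trans {α β γ : YoungDiagram} (h : RevLexLT α β) (h' : RevLexLT β γ) :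
    RevLexLT α γ := by
  obtain ⟨i, hi, hi'⟩ := h
  obtain ⟨j, hj, hj'⟩ := h'
  rcases lt_trichotomy i j with hij | rfl | hij
  · exact ⟨j, (hi' j hij).trans_lt hj, fun k hk => (hi' k (hij.trans hk)).trans (hj' k hk)⟩
  · exact ⟨i, hi.trans hj, fun k hk => (hi' k hk).trans (hj' k hk)⟩
  · exact ⟨i, hi.trans_eq (hj' i hij), fun k hk => (hi' k hk).trans (hj' k (hij.trans hk))⟩

theorem card_transpose (μ : YoungDiagram) : μ.transpose.card = μ.card := by
  simp [YoungDiagram.card, YoungDiagram.transpose]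

/-- The relation is reversed so that induction may assume the claim for all `≫`-larger partitions of
`n`. -/
theorem wellFounded_revLexGT (n : ℕ) :
    WellFounded fun μ ν : {μ : YoungDiagram // μ.card = n} => RevLexLT ν.1 μ.1 := by
  have : Finite {μ : YoungDiagram // μ.card = n} :=
    ((finite_card_le n).subset fun μ (hμ : μ.card = n) => hμ.le).to_subtype
  have : IsTrans {μ : YoungDiagram // μ.card = n} fun μ ν => RevLexLT ν.1 μ.1 :=
    ⟨fun _ _ _ h h' => h'.trans h⟩
  have : Std.Irrefl fun μ ν : {μ : YoungDiagram // μ.card = n} => RevLexLT ν.1 μ.1 :=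
    ⟨fun μ => RevLexLT.irrefl μ.1⟩
  exact Finite.wellFounded_of_trans_of_irrefl _

/-- Triangular inversion: solve for the leading term `m_ν` of `p_{ν'}`, the other terms being larger
and already in the span. -/
theorem IsFull.monomialSym_mem_span {p : YoungDiagram → SymFun K} (hp : IsFull p)
    (μ : YoungDiagram) : monomialSym K μ ∈ Submodule.span K (Set.range p) := by
  suffices h : ∀ ν : {ν : YoungDiagram // ν.card = μ.card},
      monomialSym K ν.1 ∈ Submodule.span K (Set.range p) from h ⟨μ, rfl⟩
  intro ν
  induction ν using (wellFounded_revLexGT μ.card).induction with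
  | _ ν ih =>
    obtain ⟨hom, b, hb, hb0, hsum⟩ := hp ν.1.transpose
    rw [YoungDiagram.transpose_transpose] at hb hb0
    -- Homogeneity keeps every term in one degree, where the order is well-founded.
    have hcard : ∀ ρ, b ρ ≠ 0 → ρ.card = μ.card := fun ρ hρ => by
      have h := hom (partExp ρ) (by rwa [hsum, cf_sum_monomialSym, sortVec_partExp])
      rw [← card_sortVec, sortVec_partExp, card_transpose] at h
      exact h.trans ν.2
    have hsplit : p ν.1.transpose = b ν.1 • monomialSym K ν.1 +
        (b.erase ν.1).sum fun ρ c => c • monomialSym K ρ := by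
      rw [hsum]
      exact (Finsupp.add_sum_erase b ν.1 _ (Finsupp.mem_support_iff.2 hb0)).symm
    have hrest : ((b.erase ν.1).sum fun ρ c => c • monomialSym K ρ) ∈
        Submodule.span K (Set.range p) := by
      refine Submodule.sum_mem _ fun ρ hρ => Submodule.smul_mem _ _ ?_
      classical
      rw [Finsupp.support_erase, Finset.mem_erase, Finsupp.mem_support_iff] at hρ
      exact ih ⟨ρ, hcard ρ hρ.2⟩ ((hb ρ hρ.2).resolve_left hρ.1)
    have hlead : b ν.1 • monomialSym K ν.1 ∈ Submodule.span K (Set.range p) := by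
      rw [← sub_eq_of_eq_add hsplit]
      exact Submodule.sub_mem _ (Submodule.subset_span ⟨_, rfl⟩) hrest
    exact (Submodule.smul_mem_iff _ hb0).1 hlead

theorem IsFull.span_eq_top {p : YoungDiagram → SymFun K} (hp : IsFull p) :
    Submodule.span K (Set.range p) = ⊤ := by
  rw [eq_top_iff, ← span_monomialSym, Submodule.span_le]
  rintro _ ⟨μ, rfl⟩
  exact hp.monomialSym_mem_span μ

theorem sortVec_zero : sortVec 0 = ⊥ := by
  have h := card_sortVec 0
  rw [map_zero, YoungDiagram.card, Finset.card_eq_zero] at h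
  exact YoungDiagram.ext h

/-- The empty partition is self-conjugate, so this constant term is the leading coefficient of `p
⊥`. -/
theorem IsFull.cf_zero_ne_zero {p : YoungDiagram → SymFun K} (hp : IsFull p) :
    cf 0 (p ⊥) ≠ 0 := by
  obtain ⟨-, b, -, hb0, hsum⟩ := hp ⊥
  rw [hsum, cf_sum_monomialSym, sortVec_zero]
  rwa [show (⊥ : YoungDiagram).transpose = ⊥ from YoungDiagram.ext rfl] at hb0

theorem IsFull.smul {p : YoungDiagram → SymFun K} (hp : IsFull p) {c : K} (hc : c ≠ 0) :
    IsFull fun lam => c • p lam := fun lam => by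
  obtain ⟨hom, b, hb, hb0, hsum⟩ := hp lam
  refine ⟨fun d hd => hom d fun h => hd ?_, c • b, fun μ hμ => hb μ fun h => hμ ?_,
    mul_ne_zero hc hb0, ext_cf fun d => ?_⟩
  · rw [map_smul, h, smul_zero]
  · rw [Finsupp.smul_apply, h, smul_zero]
  · rw [cf_sum_monomialSym, map_smul, hsum, cf_sum_monomialSym, Finsupp.smul_apply]

/-! ### The constant term of the convolution identity -/

theorem cf_zero_mul_algebraMap (f : SymFun K) (a : K) :
    cf 0 (f * algebraMap K (SymFun K) a) = cf 0 f * a := by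
  rw [mul_comm, ← Algebra.smul_def, map_smul, smul_eq_mul, mul_comm]

theorem coeff_convTerm (p : YoungDiagram → SymFun K) (lam : YoungDiagram) (α : ℕ →₀ ℤ) (n : ℕ) :
    cf 0 ((convTerm p lam α).coeff n) =
      cf 0 (extend p α) * (evalOne (extend p (partVec lam - α))).coeff n := by
  rw [convTerm, coeff_C_mul, coeff_map, cf_zero_mul_algebraMap]

theorem extend_partVec (p : YoungDiagram → SymFun K) (lam : YoungDiagram) :
    extend p (partVec lam) = p lam := by
  have h : ∀ i, 0 ≤ partVec lam i := fun i => Int.natCast_nonneg (lam.rowLen i)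
  rw [extend, if_pos h]
  exact congrArg p (sortVec_partExp lam)

theorem extend_zero (p : YoungDiagram → SymFun K) : extend p 0 = p ⊥ := by
  rw [extend, if_pos (show ∀ i, 0 ≤ (0 : ℕ →₀ ℤ) i from fun _ => le_rfl), Finsupp.mapRange_zero, sortVec_zero]

theorem IsFull.cf_zero_extend {p : YoungDiagram → SymFun K} (hp : IsFull p) {α : ℕ →₀ ℤ}
    (hα : α ≠ 0) : cf 0 (extend p α) = 0 := by
  rw [extend]
  split_ifs with h
  · by_contra h0
    have hdeg := (hp _).1 0 h0
    rw [map_zero, card_sortVec, eq_comm, Finsupp.degree_eq_zero_iff] at hdeg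
    refine hα (Finsupp.ext fun i => ?_)
    have hi := DFunLike.congr_fun hdeg i
    rw [Finsupp.mapRange_apply, Finsupp.zero_apply, Int.toNat_eq_zero] at hi
    exact le_antisymm hi (h i)
  · exact map_zero _

/-- The constant term, in `x₁, x₂, …`, of the coefficient of `y^n`. -/
def constCoeff (n : ℕ) : (SymFun K)[X] →ₗ[K] K :=
  (cf 0).comp ((lcoeff (SymFun K) n).restrictScalars K)

theorem constCoeff_apply (n : ℕ) (f : (SymFun K)[X]) : constCoeff n f = cf 0 (f.coeff n) := rfl

theorem constCoeff_conv {F : SymFun K →ₗ[K] (SymFun K)[X]} {p : YoungDiagram → SymFun K}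
    (hp : IsFull p) (hconv : Convolves F p) (lam : YoungDiagram) (n : ℕ) :
    constCoeff n (F (p lam)) = cf 0 (p ⊥) * (evalOne (p lam)).coeff n := by
  rw [hconv lam]
  refine ((constCoeff n).toAddMonoidHom.map_finsum (convTerm_support p lam)).trans ?_
  rw [finsum_eq_single _ 0 fun α hα => ?_]
  · change cf 0 ((convTerm p lam 0).coeff n) = _
    rw [coeff_convTerm, sub_zero, extend_partVec, extend_zero]
  · change cf 0 ((convTerm p lam α).coeff n) = 0
    rw [coeff_convTerm, hp.cf_zero_extend hα, zero_mul]

theorem coeff_shift (q : SymFun K) (n : ℕ) : (shift q).coeff n = shiftCoeff n q :=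
  coeff_polyOfCoeff _ _ n

theorem constCoeff_shift (q : SymFun K) (n : ℕ) :
    constCoeff n (shift q) = (evalOne q).coeff n := by
  rw [constCoeff_apply, coeff_shift, cf_shiftCoeff, evalOne, coeff_polyOfCoeff, consExp,
    Finsupp.embDomain_zero, add_zero]

/-! ### Shift-invariant maps are determined by their constant terms -/

/-- A linear functional of `E^a q` is a polynomial in `a`. -/
theorem exists_poly_shiftAt (q : SymFun K) (L : SymFun K →ₗ[K] K) :
    ∃ P : K[X], (∀ n, P.coeff n = L (shiftCoeff n q)) ∧ ∀ a, P.eval a = L (shiftAt a q) := by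
  refine ⟨∑ n ∈ (shift q).support, monomial n (L (shiftCoeff n q)), fun n => ?_, fun a => ?_⟩
  · rw [finsetSum_coeff]
    simp only [coeff_monomial, Finset.sum_ite_eq']
    split_ifs with h
    · rfl
    · rw [mem_support_iff, not_not, coeff_shift] at h
      rw [h, map_zero]
  · change _ = L ((shift q).eval _)
    rw [eval_finsetSum, eval_eq_sum, Polynomial.sum, map_sum]
    refine Finset.sum_congr rfl fun n _ => ?_
    rw [eval_monomial, ← map_pow, mul_comm ((shift q).coeff n), ← Algebra.smul_def, map_smul,
      coeff_shift, smul_eq_mul, mul_comm]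

/-- For each `d`, the coefficients at `x^d` of the two sides of `F E^a = E^a F` are polynomials in
`a`; agreeing on an infinite field, they have equal coefficients. -/
theorem IsShiftInvariant.coeff_shiftCoeff [Infinite K] {F : SymFun K →ₗ[K] (SymFun K)[X]}
    (hF : IsShiftInvariant F) (n k : ℕ) (q : SymFun K) :
    (F (shiftCoeff k q)).coeff n = shiftCoeff k ((F q).coeff n) := by
  refine ext_cf fun d => ?_
  let L : SymFun K →ₗ[K] K :=
    (cf d).comp (((lcoeff (SymFun K) n).restrictScalars K).comp F)
  obtain ⟨P, hP, hPe⟩ := exists_poly_shiftAt q L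
  obtain ⟨Q, hQ, hQe⟩ := exists_poly_shiftAt ((F q).coeff n) (cf d)
  have hPQ : P = Q := Polynomial.funext fun a => by
    rw [hPe, hQe, ← hF]
    rfl
  rw [← hQ, ← hPQ, hP]
  rfl

theorem cf_consExp_comm (f : SymFun K) (m n : ℕ) (d : ℕ →₀ ℕ) :
    cf (consExp m (consExp n d)) f = cf (consExp n (consExp m d)) f := by
  rw [← cf_perm f (Equiv.swap 0 1) (consExp m (consExp n d))]
  congr 2
  ext i
  obtain ⟨j, rfl⟩ := (Equiv.swap 0 1).surjective i
  have h := Finsupp.embDomain_apply_self (Equiv.swap 0 1).toEmbedding (consExp m (consExp n d)) j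
  rw [Equiv.coe_toEmbedding] at h
  rw [h]
  match j with
  | 0 => rw [Equiv.swap_apply_left]; simp [consExp_succ _ _ 0]
  | 1 => rw [Equiv.swap_apply_right]; simp [consExp_succ _ _ 0]
  | j + 2 => rw [Equiv.swap_apply_of_ne_of_ne (by omega) (by omega)]; simp

theorem exists_eq_consExp (d : ℕ →₀ ℕ) {N : ℕ} (hd : ∀ i, N + 1 ≤ i → d i = 0) :
    ∃ e : ℕ →₀ ℕ, d = consExp (d 0) e ∧ ∀ i, N ≤ i → e i = 0 := by
  refine ⟨d.comapDomain Nat.succ Nat.succ_injective.injOn, Finsupp.ext fun i => ?_,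
    fun i hi => hd (i + 1) (by omega)⟩
  cases i with
  | zero => rw [consExp_zero]
  | succ i => rw [consExp_succ]; rfl

/-- A shift-invariant map whose constant terms are those of `c E^y` is `c E^y`. -/
theorem IsShiftInvariant.eq_smul_shift [Infinite K] {F : SymFun K →ₗ[K] (SymFun K)[X]}
    (hF : IsShiftInvariant F) {c : K}
    (h : ∀ n q, constCoeff n (F q) = c * constCoeff n (shift q)) : F = c • shift := by
  -- Induction on the number `N` of variables that `x^d` may involve, for all `q` at once, since the
  -- step replaces `q` by `shiftCoeff (d 0) q`.
  have key : ∀ (n N : ℕ) (d : ℕ →₀ ℕ), (∀ i, N ≤ i → d i = 0) → ∀ q,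
      cf d ((F q).coeff n) = c * cf (consExp n d) q := by
    intro n N
    induction N with
    | zero =>
      intro d hd q
      obtain rfl : d = 0 := Finsupp.ext fun i => hd i i.zero_le
      rw [← constCoeff_apply, h, constCoeff_apply, coeff_shift, cf_shiftCoeff]
    | succ N ih =>
      intro d hd q
      obtain ⟨e, he, he'⟩ := exists_eq_consExp d hd
      -- Split off the first variable and move its coefficient operator inside `F`. This leaves `d
      -- 0` in front of `n`, and symmetry of `q` swaps them back.
      rw [he, ← cf_shiftCoeff, ← hF.coeff_shiftCoeff, ih e he', cf_shiftCoeff, cf_consExp_comm]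
  refine LinearMap.ext fun q => Polynomial.ext fun n => ext_cf fun d => ?_
  obtain ⟨N, hN⟩ := d.support.exists_nat_subset_range
  rw [key n N d fun i hi => ?_, LinearMap.smul_apply, coeff_smul, coeff_shift, map_smul,
    cf_shiftCoeff, smul_eq_mul]
  by_contra hne
  exact absurd (Finset.mem_range.1 (hN (Finsupp.mem_support_iff.2 hne))) (by omega)

/-! ### Rescaling -/

theorem extend_smul (c : K) (p : YoungDiagram → SymFun K) (α : ℕ →₀ ℤ) :
    extend (fun lam => c • p lam) α = c • extend p α := by
  rw [extend, extend]
  split_ifs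
  · rfl
  · rw [smul_zero]

theorem evalOne_smul (c : K) (f : SymFun K) : evalOne (c • f) = c • evalOne f := by
  ext n
  simp [evalOne]

theorem convTerm_smul (c : K) (p : YoungDiagram → SymFun K) (lam : YoungDiagram) (α : ℕ →₀ ℤ) :
    convTerm (fun lam => c • p lam) lam α = (c * c) • convTerm p lam α := by
  rw [convTerm, convTerm, extend_smul, extend_smul, evalOne_smul]
  ext1 n
  simp only [coeff_C_mul, coeff_map, coeff_smul, smul_eq_mul, map_mul, ← Algebra.smul_def,
    smul_mul_assoc, mul_smul_comm, mul_smul]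

/-- The right side scales by `c⁻²` and the left by `c⁻¹`; the factor `c` in `c • F` makes up the
difference. -/
theorem Convolves.rescale {F : SymFun K →ₗ[K] (SymFun K)[X]} {p : YoungDiagram → SymFun K}
    {c : K} (hc : c ≠ 0) (h : Convolves (c • F) p) : Convolves F fun lam => c⁻¹ • p lam := by
  intro lam
  simp only [convTerm_smul]
  rw [← smul_finsum' _ (convTerm_support p lam), ← h lam, map_smul, LinearMap.smul_apply, smul_smul,
    mul_assoc, inv_mul_cancel₀ hc, mul_one]

end ShefferSym

end

theorem mainTheorem3 {K : Type*} [Field K] [CharZero K]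
    (F : ShefferSym.SymFun K →ₗ[K] Polynomial (ShefferSym.SymFun K))
    (p : YoungDiagram → ShefferSym.SymFun K)
    (hp : ShefferSym.IsFull p)
    (hF : ShefferSym.IsShiftInvariant F)
    (hconv : ShefferSym.Convolves F p) :
    ∃ c : K, c ≠ 0 ∧ F = c • ShefferSym.shift ∧
      ∃ q : YoungDiagram → ShefferSym.SymFun K,
        ShefferSym.IsFullDividedPower q ∧ ∀ lam : YoungDiagram, p lam = c • q lam := by
  -- Forced by the `α = 0` term of the convolution, whose first factor is `p_∅`.
  let c := ShefferSym.cf 0 (p ⊥)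
  have hc : c ≠ 0 := hp.cf_zero_ne_zero
  have hconst : ∀ n, (ShefferSym.constCoeff n).comp F =
      c • (ShefferSym.constCoeff n).comp ShefferSym.shift := fun n => by
    refine LinearMap.ext_on_range hp.span_eq_top fun lam => ?_
    rw [LinearMap.smul_apply, LinearMap.comp_apply, LinearMap.comp_apply,
      ShefferSym.constCoeff_conv hp hconv, ShefferSym.constCoeff_shift, smul_eq_mul]
  have hshift : F = c • ShefferSym.shift :=
    hF.eq_smul_shift fun n q => LinearMap.congr_fun (hconst n) q
  refine ⟨c, hc, hshift, fun lam => c⁻¹ • p lam, ⟨hp.smul (inv_ne_zero hc), ?_⟩, fun lam => ?_⟩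
  · rw [hshift] at hconv
    exact hconv.rescale hc
  · rw [smul_smul, mul_inv_cancel₀ hc, one_smul]
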